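/- Let $G$ be a simple undirected graph on the vertex set $\{0,\dots,n-1\}$. For a vertex $v$ with neighbourhood $N_v$, the local complementation $G^v$ is obtained from $G$ by replacing the subgraph induced on $N_v$ by its complement. The LC orbit $[G]$ is the set of all graphs on $\{0,\dots,n-1\}$ that can be transformed into $G$ by a finite sequence of local complementations and vertex permutations. Let $\alpha(K)$ be the independence number of $K$, and put $\lambda(G)=\max_{K\in[G]}\alpha(K)$. A Boolean function $f:\mathbb{Z}_2^n\to\mathbb{Z}_2$ corresponds to a graph $K=(V,E)$ if $$f(\boldsymbol{x})=\sum_{\{i,j\}\in E}x_ix_j+\boldsymbol{b}\cdot\boldsymbol{x}+c \quad\text{for some } \boldsymbol{b}\in\mathbb{Z}_2^n,\ c\in\mathbb{Z}_2.$$ Let $\boldsymbol{s}=2^{-n/2}(-1)^{f(\boldsymbol{x})}$ be the associated vector of length $2^n$. Let $\mathcal{U}$ be the set of all matrices $$\begin{pmatrix}\cos\theta & \sin\theta\, e^{i\phi}\\ \sin\theta & -\cos\theta\, e^{i\phi}\end{pmatrix},\qquad \theta,\phi\in\mathbb{R},$$ let $\mathcal{U}^n$ be the set of all $U=U_0\otimes\cdots\otimes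 U_{n-1}$ with every $U_i\in\mathcal{U}$, and define $$\mathrm{PAR}_{\mathcal{U}}(\boldsymbol{s})=2^n\max_{U\in\mathcal{U}^n,\;k\in\mathbb{Z}_2^n}|(U\boldsymbol{s})_k|^2 .$$ If the LC orbit $[G]$ contains a bipartite graph, then for every function $f$ that corresponds to a graph in $[G]$ the maximum defining $\mathrm{PAR}_{\mathcal{U}}(\boldsymbol{s})$ is attained, and $\mathrm{PAR}_{\mathcal{U}}(\boldsymbol{s})=2^{\lambda(G)}$. -/

import Mathlib

namespace BipartiteLC

open scoped Matrix

/-- Local complementation at `v`: the subgraph induced on the neighbourhood of `v` is replaced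
by its complement, all other pairs are left unchanged. -/
def localComplement {n : ℕ} (G : SimpleGraph (Fin n)) (v : Fin n) : SimpleGraph (Fin n) where
  Adj a b := (G.Adj v a ∧ G.Adj v b ∧ a ≠ b ∧ ¬ G.Adj a b) ∨
    (¬ (G.Adj v a ∧ G.Adj v b) ∧ G.Adj a b)
  symm := ⟨fun a b h => by
    rcases h with ⟨h1, h2, h3, h4⟩ | ⟨h1, h2⟩
    · exact Or.inl ⟨h2, h1, h3.symm, fun h => h4 h.symm⟩
    · exact Or.inr ⟨fun h => h1 ⟨h.2, h.1⟩, h2.symm⟩⟩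
  loopless := ⟨fun a h => by
    rcases h with ⟨_, _, h, _⟩ | ⟨_, h⟩
    · exact h rfl
    · exact G.loopless.irrefl a h⟩

/-- `K'` arises from `K` by one local complementation or by one vertex permutation. -/
def LCStep {n : ℕ} (K K' : SimpleGraph (Fin n)) : Prop :=
  (∃ v : Fin n, K' = localComplement K v) ∨
    (∃ π : Equiv.Perm (Fin n), K' = K.map π.toEmbedding)

/-- The LC orbit `[G]`: all graphs on the same vertex set that can be transformed into `G` by a
finite sequence of local complementations and vertex permutations. -/
def lcOrbit {n : ℕ} (G : SimpleGraph (Fin n)) : Set (SimpleGraph (Fin n)) :=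
  {K | Relation.ReflTransGen LCStep K G}

/-- `λ(G)`, the maximum of the independence number over the LC orbit of `G`. -/
noncomputable def lam {n : ℕ} (G : SimpleGraph (Fin n)) : ℕ :=
  sSup (SimpleGraph.indepNum '' lcOrbit G)

/-- The supremum in `lam` is a maximum. -/
theorem isGreatest_lam {n : ℕ} (G : SimpleGraph (Fin n)) :
    IsGreatest (SimpleGraph.indepNum '' lcOrbit G) (lam G) := by
  have hne : (SimpleGraph.indepNum '' lcOrbit G).Nonempty :=
    ⟨_, G, Relation.ReflTransGen.refl, rfl⟩
  have hb : BddAbove (SimpleGraph.indepNum '' lcOrbit G) := (Set.toFinite _).bddAbove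
  exact ⟨Nat.sSup_mem hne hb, fun a ha => le_csSup hb ha⟩

open Classical in
/-- The Boolean function `f` corresponds to the graph `K`: its algebraic normal form has no terms
of degree above two, and the monomial `x_i x_j` (`i < j`) occurs in it exactly when `i j` is an
edge. Linear and constant terms are arbitrary. -/
def Corresponds {n : ℕ} (f : (Fin n → ZMod 2) → ZMod 2) (K : SimpleGraph (Fin n)) : Prop :=
  ∃ (b : Fin n → ZMod 2) (c : ZMod 2), ∀ x : Fin n → ZMod 2,
    f x = (∑ p : Fin n × Fin n with p.1 < p.2 ∧ K.Adj p.1 p.2, x p.1 * x p.2) +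
      (∑ i, b i * x i) + c

/-- The vector `s = 2^(-n/2) (-1)^f` of length `2^n`, indexed by the binary words of length `n`. -/
noncomputable def signVector {n : ℕ} (f : (Fin n → ZMod 2) → ZMod 2) : (Fin n → ZMod 2) → ℂ :=
  fun x => (((2 : ℝ) ^ (-(n : ℝ) / 2) : ℝ) : ℂ) * (-1) ^ (f x).val

/-- The tensor product `U_0 ⊗ ⋯ ⊗ U_{n-1}` of `2 × 2` matrices. -/
def tensor {n : ℕ} (U : Fin n → Matrix (ZMod 2) (ZMod 2) ℂ) :
    Matrix (Fin n → ZMod 2) (Fin n → ZMod 2) ℂ :=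
  Matrix.of fun k x => ∏ i, U i (k i) (x i)

/-- The values `2^n |S_k|^2`, where `S = U s`, over all `U ∈ T^n` and all indices `k`. -/
def powerSpectrum {n : ℕ} (T : Set (Matrix (ZMod 2) (ZMod 2) ℂ)) (s : (Fin n → ZMod 2) → ℂ) :
    Set ℝ :=
  {r | ∃ (U : Fin n → Matrix (ZMod 2) (ZMod 2) ℂ) (k : Fin n → ZMod 2),
    (∀ i, U i ∈ T) ∧ r = 2 ^ n * ‖(tensor U *ᵥ s) k‖ ^ 2}

/-- The peak-to-average power ratio of `s` with respect to `T^n`. -/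
noncomputable def PAR {n : ℕ} (T : Set (Matrix (ZMod 2) (ZMod 2) ℂ))
    (s : (Fin n → ZMod 2) → ℂ) : ℝ :=
  sSup (powerSpectrum T s)

/-- The matrix with rows `(cos θ, sin θ e^{iφ})` and `(sin θ, -cos θ e^{iφ})`. -/
noncomputable def uMatrix (θ φ : ℝ) : Matrix (ZMod 2) (ZMod 2) ℂ :=
  Matrix.of fun r c =>
    if r = 0 then
      if c = 0 then (Real.cos θ : ℂ) else (Real.sin θ : ℂ) * Complex.exp (Complex.I * φ)
    else
      if c = 0 then (Real.sin θ : ℂ) else -(Real.cos θ : ℂ) * Complex.exp (Complex.I * φ)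

/-- The infinite transform set `𝓤`: all matrices `uMatrix θ φ` with `θ`, `φ` real. -/
def transformU : Set (Matrix (ZMod 2) (ZMod 2) ℂ) :=
  {M | ∃ θ φ : ℝ, M = uMatrix θ φ}

end BipartiteLC

/-!
Up to normalisation, the power spectrum of `s` for all local unitary transforms consists of the
squared overlaps of `s` with product vectors of norm one. This set does not change under local
unitaries or permutations of the coordinates. A local complementation at `v` acts on the graph state
as a square root of the bit flip at `v` followed by diagonal phases, so the set is the same for all
graphs of an LC orbit.

Lower bound: if `T` is independent, the product vector that is uniform on `T` and concentrated at
`0` elsewhere has squared overlap `2 ^ #T` with the graph state.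

Upper bound: let `X` be a side of a bipartite graph `B` of the orbit. A Hadamard transform of the
coordinates outside `X` turns the graph state into a multiple of the indicator function of a binary
linear code `C` with information set `X`. By Cauchy-Schwarz across any cut `S`, `Sᶜ`, all squared
overlaps are at most `2 ^ (#Xᶜ + d S + d Sᶜ)`, where `d A` is the dimension of the space of
codewords that vanish on `A`. As `d` is supermodular, a min-max theorem of matroid intersection type
yields sets `I` and `S` with `d S + d Sᶜ + #Iᶜ ≤ 2 * d I`. Pivoting on an edge between the two sides
stays in the orbit, keeps `C` and exchanges one element of `X`. If `#(X ∩ I)` is maximal under such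
pivots, there is no edge between `X \ I` and `I \ X`, so `symmDiff X I` is independent. Since
`d I ≤ #(X \ I)`, its size `2 * #(X \ I) + #Xᶜ - #Iᶜ` is at least the exponent of the upper bound.
-/

namespace BipartiteLC

open scoped Matrix Finset

/-- The sign `(-1) ^ a` of a bit, as an additive character. -/
def signChar : AddChar (ZMod 2) ℂ :=
  AddChar.zmodChar 2 (neg_one_sq : (-1 : ℂ) ^ 2 = 1)

theorem signChar_apply (a : ZMod 2) : signChar a = (-1) ^ a.val :=
  AddChar.zmodChar_apply _ a

section ProductVector

variable {ι κ : Type*} [Fintype ι]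

/-- The rank-one tensor `⨂ i, v i`, as a function on words. -/
def productVector {R : Type*} [CommMonoid R] (v : ι → κ → R) (x : ι → κ) : R :=
  ∏ i, v i (x i)

theorem productVector_smul {R : Type*} [CommSemiring R] (ζ : ι → R) (v : ι → κ → R) :
    productVector (fun i => ζ i • v i) = (∏ i, ζ i) • productVector v :=
  funext fun _ => Finset.prod_mul_distrib

theorem productVector_comp_perm {R : Type*} [CommMonoid R] (v : ι → κ → R) (π : Equiv.Perm ι)
    (x : ι → κ) : productVector (fun i => v (π i)) (x ∘ π) = productVector v x :=
  Equiv.prod_comp π fun i => v i (x i)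

variable [Fintype κ]

theorem dotProduct_star_self_eq_sum_norm_sq (w : κ → ℂ) :
    w ⬝ᵥ star w = ((∑ a, ‖w a‖ ^ 2 : ℝ) : ℂ) := by
  simp [dotProduct, Complex.mul_conj']

theorem sum_norm_sq_vecMul [DecidableEq κ] {W : Matrix κ κ ℂ} {t : ℝ}
    (hW : W * star W = (t : ℂ) • 1) (w : κ → ℂ) :
    ∑ a, ‖(w ᵥ* W) a‖ ^ 2 = t * ∑ a, ‖w a‖ ^ 2 := by
  have h : (w ᵥ* W) ⬝ᵥ star (w ᵥ* W) = t * (w ⬝ᵥ star w) := by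
    rw [Matrix.star_vecMul, ← Matrix.dotProduct_mulVec, Matrix.mulVec_mulVec,
      ← Matrix.star_eq_conjTranspose, hW, Matrix.smul_mulVec, Matrix.one_mulVec, dotProduct_smul,
      smul_eq_mul]
  rw [dotProduct_star_self_eq_sum_norm_sq, dotProduct_star_self_eq_sum_norm_sq] at h
  exact_mod_cast h

/-- The vectors of Euclidean norm one, stated for plain functions, whose own norm is the supremum
norm. -/
def IsUnitVec (w : κ → ℂ) : Prop :=
  ∑ a, ‖w a‖ ^ 2 = 1

theorem IsUnitVec.vecMul [DecidableEq κ] {w : κ → ℂ} (hw : IsUnitVec w) {W : Matrix κ κ ℂ}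
    (hW : W ∈ Matrix.unitaryGroup κ ℂ) : IsUnitVec (w ᵥ* W) := by
  rw [IsUnitVec, sum_norm_sq_vecMul (t := 1) (by simp [Matrix.mem_unitaryGroup_iff.mp hW]), hw,
    one_mul]

variable [DecidableEq ι]

theorem sum_productVector {R : Type*} [CommSemiring R] (v : ι → κ → R) :
    ∑ x, productVector v x = ∏ i, ∑ a, v i a :=
  (Fintype.prod_sum v).symm

/-- The squared overlaps of `s` with product vectors of norm one; up to normalisation, its power
spectrum with respect to all local unitary transforms. -/
def productSpectrum (s : (ι → κ) → ℂ) : Set ℝ :=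
  {r | ∃ v : ι → κ → ℂ, (∀ i, IsUnitVec (v i)) ∧ r = ‖productVector v ⬝ᵥ s‖ ^ 2}

theorem productSpectrum_smul {ζ : ℂ} (hζ : ‖ζ‖ = 1) (s : (ι → κ) → ℂ) :
    productSpectrum (ζ • s) = productSpectrum s := by
  simp only [productSpectrum, dotProduct_smul, norm_smul, hζ, one_mul]

theorem productSpectrum_comp_perm_subset (s : (ι → κ) → ℂ) (π : Equiv.Perm ι) :
    productSpectrum (fun x => s (x ∘ π)) ⊆ productSpectrum s := by
  rintro r ⟨v, hv, rfl⟩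
  refine ⟨fun i => v (π i), fun i => hv _, ?_⟩
  simp only [dotProduct, ← productVector_comp_perm v π]
  exact congrArg (‖·‖ ^ 2) ((Equiv.arrowCongr π.symm (Equiv.refl κ)).sum_comp fun x =>
    productVector (fun i => v (π i)) x * s x)

theorem productSpectrum_comp_perm (s : (ι → κ) → ℂ) (π : Equiv.Perm ι) :
    productSpectrum (fun x => s (x ∘ π)) = productSpectrum s := by
  refine (productSpectrum_comp_perm_subset s π).antisymm ?_
  have h := productSpectrum_comp_perm_subset (fun x => s (x ∘ π)) π.symm
  simpa [Function.comp_assoc] using h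

end ProductVector

section Tensor

variable {n : ℕ}

theorem tensor_mulVec_apply (U : Fin n → Matrix (ZMod 2) (ZMod 2) ℂ) (s : (Fin n → ZMod 2) → ℂ)
    (k : Fin n → ZMod 2) :
    (tensor U *ᵥ s) k = productVector (fun i => U i (k i)) ⬝ᵥ s :=
  rfl

theorem productVector_vecMul_tensor (v : Fin n → ZMod 2 → ℂ)
    (W : Fin n → Matrix (ZMod 2) (ZMod 2) ℂ) :
    productVector v ᵥ* tensor W = productVector fun i => v i ᵥ* W i := by
  ext x
  exact (Finset.sum_congr rfl fun k _ => Finset.prod_mul_distrib.symm).trans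
    (sum_productVector fun i a => v i a * W i a (x i))

theorem productVector_dotProduct_tensor_mulVec (v : Fin n → ZMod 2 → ℂ)
    (W : Fin n → Matrix (ZMod 2) (ZMod 2) ℂ) (s : (Fin n → ZMod 2) → ℂ) :
    productVector v ⬝ᵥ (tensor W *ᵥ s) = productVector (fun i => v i ᵥ* W i) ⬝ᵥ s := by
  rw [Matrix.dotProduct_mulVec, productVector_vecMul_tensor]

theorem productSpectrum_tensor_mulVec {W : Fin n → Matrix (ZMod 2) (ZMod 2) ℂ}
    (hW : ∀ i, W i ∈ Matrix.unitaryGroup (ZMod 2) ℂ) (s : (Fin n → ZMod 2) → ℂ) :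
    productSpectrum (tensor W *ᵥ s) = productSpectrum s := by
  ext r
  constructor
  · rintro ⟨v, hv, rfl⟩
    exact ⟨_, fun i => (hv i).vecMul (hW i), by rw [productVector_dotProduct_tensor_mulVec]⟩
  · rintro ⟨v, hv, rfl⟩
    refine ⟨_, fun i => (hv i).vecMul (Unitary.star_mem (hW i)), ?_⟩
    simp only [productVector_dotProduct_tensor_mulVec, Matrix.vecMul_vecMul,
      Matrix.mem_unitaryGroup_iff'.mp (hW _), Matrix.vecMul_one]

theorem tensor_diagonal (d : Fin n → ZMod 2 → ℂ) :
    tensor (fun i => Matrix.diagonal (d i)) = Matrix.diagonal (productVector d) := by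
  ext k x
  rcases eq_or_ne k x with rfl | hkx
  · simp [tensor, productVector]
  · obtain ⟨i, hi⟩ := Function.ne_iff.mp hkx
    rw [Matrix.diagonal_apply_ne _ hkx]
    exact Finset.prod_eq_zero (Finset.mem_univ i) (Matrix.diagonal_apply_ne _ hi)

theorem diagonal_mem_unitaryGroup {κ : Type*} [Fintype κ] [DecidableEq κ] {d : κ → ℂ}
    (hd : ∀ a, ‖d a‖ = 1) : Matrix.diagonal d ∈ Matrix.unitaryGroup κ ℂ := by
  rw [Matrix.mem_unitaryGroup_iff, Matrix.star_eq_conjTranspose, Matrix.diagonal_conjTranspose,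
    Matrix.diagonal_mul_diagonal, ← Matrix.diagonal_one]
  congr 1
  ext a
  simp [Complex.mul_conj', hd]

theorem productSpectrum_productVector_mul {d : Fin n → ZMod 2 → ℂ} (hd : ∀ i a, ‖d i a‖ = 1)
    (s : (Fin n → ZMod 2) → ℂ) :
    productSpectrum (fun x => productVector d x * s x) = productSpectrum s := by
  rw [← productSpectrum_tensor_mulVec (fun i => diagonal_mem_unitaryGroup (hd i)) s,
    tensor_diagonal]
  congr 1
  ext x
  rw [Matrix.mulVec_diagonal]

theorem tensor_update_one_mulVec (v : Fin n) (W : Matrix (ZMod 2) (ZMod 2) ℂ)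
    (s : (Fin n → ZMod 2) → ℂ) (x : Fin n → ZMod 2) :
    (tensor (Function.update 1 v W) *ᵥ s) x = ∑ a, W (x v) a * s (Function.update x v a) := by
  have hentry (y : Fin n → ZMod 2) : tensor (Function.update 1 v W) x y =
      W (x v) (y v) * ∏ i ∈ Finset.univ.erase v, (1 : Matrix (ZMod 2) (ZMod 2) ℂ) (x i) (y i) := by
    rw [tensor, Matrix.of_apply, ← Finset.mul_prod_erase _ _ (Finset.mem_univ v),
      Function.update_self]
    refine congrArg _ (Finset.prod_congr rfl fun i hi => ?_)
    rw [Function.update_of_ne (Finset.ne_of_mem_erase hi), Pi.one_apply]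
  change ∑ y, tensor (Function.update 1 v W) x y * s y = _
  refine (Fintype.sum_of_injective _ (Function.update_injective x v) _ _ (fun y hy => ?_)
    fun a => ?_).symm
  · obtain ⟨i, hi⟩ := Function.ne_iff.mp fun h => hy ⟨y v, h⟩
    have hiv : i ≠ v := by
      rintro rfl
      exact hi (Function.update_self ..)
    rw [Function.update_of_ne hiv] at hi
    have hzero : ∏ i ∈ Finset.univ.erase v, (1 : Matrix (ZMod 2) (ZMod 2) ℂ) (x i) (y i) = 0 :=
      Finset.prod_eq_zero (Finset.mem_erase.mpr ⟨hiv, Finset.mem_univ i⟩) (Matrix.one_apply_ne hi)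
    rw [hentry, hzero, mul_zero, zero_mul]
  · rw [hentry, Function.update_self, Finset.prod_eq_one, mul_one]
    intro i hi
    rw [Function.update_of_ne (Finset.ne_of_mem_erase hi), Matrix.one_apply_eq]

end Tensor

section Unitary

theorem zmod_two_cases (a : ZMod 2) : a = 0 ∨ a = 1 := by
  revert a
  decide

theorem sum_zmod_two {M : Type*} [AddCommMonoid M] (g : ZMod 2 → M) : ∑ a, g a = g 0 + g 1 :=
  Fin.sum_univ_two g

theorem isUnitVec_uMatrix_row (θ φ : ℝ) (k : ZMod 2) : IsUnitVec (uMatrix θ φ k) := by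
  have hφ : ‖Complex.exp (Complex.I * φ)‖ = 1 := by
    rw [mul_comm, Complex.norm_exp_ofReal_mul_I]
  rcases zmod_two_cases k with rfl | rfl <;>
    simp [IsUnitVec, sum_zmod_two, uMatrix, hφ, -Complex.ofReal_cos, -Complex.ofReal_sin]

theorem IsUnitVec.exists_eq_smul_row {w : ZMod 2 → ℂ} (hw : IsUnitVec w) :
    ∃ U ∈ transformU, ∃ ζ : ℂ, ‖ζ‖ = 1 ∧ w = ζ • U 0 := by
  let z : ℂ := ⟨‖w 0‖, ‖w 1‖⟩
  have hz : ‖z‖ = 1 := by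
    rw [← sq_eq_sq₀ (norm_nonneg z) zero_le_one, one_pow, Complex.sq_norm, Complex.normSq_apply,
      ← sq, ← sq, ← sum_zmod_two fun a => ‖w a‖ ^ 2, hw]
  have hcos : Real.cos z.arg = ‖w 0‖ := by simpa [hz] using Complex.norm_mul_cos_arg z
  have hsin : Real.sin z.arg = ‖w 1‖ := by simpa [hz] using Complex.norm_mul_sin_arg z
  refine ⟨_, ⟨z.arg, (w 1).arg - (w 0).arg, rfl⟩, Complex.exp ((w 0).arg * Complex.I),
    Complex.norm_exp_ofReal_mul_I _, ?_⟩
  ext a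
  rcases zmod_two_cases a with rfl | rfl
  · simp [uMatrix, -Complex.ofReal_cos, hcos, mul_comm _ ((‖w 0‖ : ℂ))]
  · have hphase :
        Complex.exp ((w 0).arg * Complex.I) * Complex.exp (Complex.I * ((w 1).arg - (w 0).arg)) =
          Complex.exp ((w 1).arg * Complex.I) := by
      rw [← Complex.exp_add]
      ring_nf
    simp [uMatrix, -Complex.ofReal_sin, hsin, mul_left_comm _ (‖w 1‖ : ℂ), hphase]

theorem signVector_eq_smul {n : ℕ} (f : (Fin n → ZMod 2) → ZMod 2) :
    signVector f = (((2 : ℝ) ^ (-(n : ℝ) / 2) : ℝ) : ℂ) • fun x => signChar (f x) := by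
  ext x
  simp [signVector, signChar_apply]

theorem two_pow_mul_norm_rpow_smul_sq (n : ℕ) (z : ℂ) :
    2 ^ n * ‖(((2 : ℝ) ^ (-(n : ℝ) / 2) : ℝ) : ℂ) • z‖ ^ 2 = ‖z‖ ^ 2 := by
  have h : ((2 : ℝ) ^ (-(n : ℝ) / 2)) ^ 2 = (2 ^ n)⁻¹ := by
    rw [← Real.rpow_mul_natCast two_pos.le, Nat.cast_two, div_mul_cancel₀ _ two_ne_zero,
      Real.rpow_neg two_pos.le, Real.rpow_natCast]
  rw [norm_smul, mul_pow, Complex.norm_real, Real.norm_eq_abs, sq_abs, h,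
    mul_inv_cancel_left₀ (by positivity)]

theorem powerSpectrum_transformU_signVector {n : ℕ} (f : (Fin n → ZMod 2) → ZMod 2) :
    powerSpectrum transformU (signVector f) = productSpectrum fun x => signChar (f x) := by
  simp only [powerSpectrum, tensor_mulVec_apply, signVector_eq_smul, dotProduct_smul,
    two_pow_mul_norm_rpow_smul_sq]
  ext r
  constructor
  · rintro ⟨U, k, hU, rfl⟩
    refine ⟨_, fun i => ?_, rfl⟩
    obtain ⟨θ, φ, hi⟩ := hU i
    exact hi ▸ isUnitVec_uMatrix_row θ φ (k i)
  · rintro ⟨v, hv, rfl⟩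
    choose U hU ζ hζ hvU using fun i => (hv i).exists_eq_smul_row
    refine ⟨U, 0, hU, ?_⟩
    obtain rfl : v = fun i => ζ i • U i 0 := funext hvU
    rw [productVector_smul, smul_dotProduct, norm_smul, norm_prod,
      Finset.prod_congr rfl fun i _ => hζ i, Finset.prod_const_one, one_mul]
    rfl

end Unitary

section BinaryAdjacency

variable {V : Type*}

open Classical in
/-- The adjacency matrix over the field with two elements. -/
noncomputable def binAdj (K : SimpleGraph V) : Matrix V V (ZMod 2) :=
  K.adjMatrix (ZMod 2)

theorem binAdj_comm (K : SimpleGraph V) (i j : V) : binAdj K i j = binAdj K j i := by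
  classical exact K.isSymm_adjMatrix.apply j i

@[simp]
theorem binAdj_self (K : SimpleGraph V) (i : V) : binAdj K i i = 0 := by
  simp [binAdj]

theorem binAdj_eq_one_iff {K : SimpleGraph V} {i j : V} : binAdj K i j = 1 ↔ K.Adj i j := by
  simp [binAdj, SimpleGraph.adjMatrix_apply]

theorem binAdj_eq_zero_iff {K : SimpleGraph V} {i j : V} : binAdj K i j = 0 ↔ ¬K.Adj i j := by
  simp [binAdj, SimpleGraph.adjMatrix_apply]

theorem binAdj_injective : Function.Injective (binAdj : SimpleGraph V → _) := fun K L h => by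
  ext i j
  rw [← binAdj_eq_one_iff, h, binAdj_eq_one_iff]

theorem binAdj_map (K : SimpleGraph V) (π : Equiv.Perm V) :
    (binAdj (K.map π.toEmbedding)).submatrix π π = binAdj K := by
  ext i j
  simp only [Matrix.submatrix_apply, binAdj, SimpleGraph.adjMatrix_apply]
  congr 1
  exact propext (SimpleGraph.map_adj_apply (f := π.toEmbedding))

end BinaryAdjacency

section EdgeForm

variable {V : Type*} [LinearOrder V]

/-- The strictly upper triangular part of the adjacency matrix over the field with two elements; it
counts every edge once, whereas the form of the full matrix vanishes in characteristic two. -/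
noncomputable def upperAdj (K : SimpleGraph V) : Matrix V V (ZMod 2) :=
  Matrix.of fun i j => if i < j then binAdj K i j else 0

theorem upperAdj_add_transpose (K : SimpleGraph V) : upperAdj K + (upperAdj K)ᵀ = binAdj K := by
  ext i j
  rcases lt_trichotomy i j with h | rfl | h
  · simp [upperAdj, h, h.not_gt]
  · simp [upperAdj]
  · simp [upperAdj, h, h.not_gt, binAdj_comm K i j]

variable [Fintype V]

/-- The quadratic form `∑ x i * x j` over the edges `{i, j}` of `K`. -/
noncomputable def edgeForm (K : SimpleGraph V) (x : V → ZMod 2) : ZMod 2 :=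
  x ⬝ᵥ upperAdj K *ᵥ x

open Classical in
theorem edgeForm_eq_sum_filter (K : SimpleGraph V) (x : V → ZMod 2) :
    edgeForm K x = ∑ p : V × V with p.1 < p.2 ∧ K.Adj p.1 p.2, x p.1 * x p.2 := by
  rw [Finset.sum_filter, Fintype.sum_prod_type, edgeForm, dotProduct]
  refine Finset.sum_congr rfl fun i _ => ?_
  rw [Matrix.mulVec, dotProduct, Finset.mul_sum]
  refine Finset.sum_congr rfl fun j _ => ?_
  by_cases hlt : i < j <;> by_cases hadj : K.Adj i j <;>
    simp [upperAdj, hlt, hadj, binAdj, SimpleGraph.adjMatrix_apply]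

theorem edgeForm_add (K : SimpleGraph V) (x y : V → ZMod 2) :
    edgeForm K (x + y) = edgeForm K x + edgeForm K y + y ⬝ᵥ binAdj K *ᵥ x := by
  have hswap : x ⬝ᵥ upperAdj K *ᵥ y = y ⬝ᵥ (upperAdj K)ᵀ *ᵥ x := by
    rw [Matrix.mulVec_transpose, Matrix.dotProduct_mulVec, dotProduct_comm]
  simp only [edgeForm, ← upperAdj_add_transpose K, Matrix.mulVec_add, Matrix.add_mulVec,
    add_dotProduct, dotProduct_add, hswap]
  ring

theorem edgeForm_eq_zero {K : SimpleGraph V} {x : V → ZMod 2}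
    (hx : K.IsIndepSet (Function.support x)) : edgeForm K x = 0 := by
  classical
  rw [edgeForm_eq_sum_filter]
  refine Finset.sum_eq_zero fun p hp => ?_
  by_contra hne
  obtain ⟨hi, hj⟩ := mul_ne_zero_iff.mp hne
  obtain ⟨hlt, hadj⟩ := (Finset.mem_filter.mp hp).2
  exact hx hi hj hlt.ne hadj

theorem edgeForm_single (K : SimpleGraph V) (i : V) (a : ZMod 2) :
    edgeForm K (Pi.single i a) = 0 :=
  edgeForm_eq_zero (Set.Subsingleton.pairwise
    (Set.subsingleton_singleton.anti Pi.support_single_subset) _)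

theorem eq_edgeForm {K : SimpleGraph V} {q : (V → ZMod 2) → ZMod 2}
    (hadd : ∀ x y, q (x + y) = q x + q y + y ⬝ᵥ binAdj K *ᵥ x)
    (hsingle : ∀ i a, q (Pi.single i a) = 0) : q = edgeForm K := by
  let d : (V → ZMod 2) →+ ZMod 2 := AddMonoidHom.mk' (fun x => q x - edgeForm K x) fun x y => by
    rw [hadd, edgeForm_add]
    ring
  have hd : d = 0 := AddMonoidHom.functions_ext _ _ _ fun i a => by
    simp [d, hsingle, edgeForm_single]
  exact funext fun x => sub_eq_zero.mp (DFunLike.congr_fun hd x)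

theorem edgeForm_map (K : SimpleGraph V) (π : Equiv.Perm V) (x : V → ZMod 2) :
    edgeForm (K.map π.toEmbedding) x = edgeForm K (x ∘ π) := by
  refine (congrFun (eq_edgeForm (q := fun x => edgeForm K (x ∘ π)) (fun x y => ?_)
    fun i a => ?_) x).symm
  · change edgeForm K (x ∘ π + y ∘ π) = _
    rw [edgeForm_add, ← binAdj_map K π, Matrix.submatrix_mulVec_equiv, Function.comp_assoc,
      Equiv.self_comp_symm, Function.comp_id, comp_equiv_dotProduct_comp_equiv]
  · rw [show (Pi.single i a : V → ZMod 2) ∘ π = Pi.single (π.symm i) a from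
      Pi.single_comp_equiv π i a, edgeForm_single]

end EdgeForm

section LocalComplement

variable {n : ℕ}

theorem binAdj_localComplement (K : SimpleGraph (Fin n)) (v i j : Fin n) :
    binAdj (localComplement K v) i j =
      binAdj K i j + binAdj K v i * binAdj K v j + if i = j then binAdj K v i else 0 := by
  classical
  rcases eq_or_ne i j with rfl | hij
  · by_cases hi : K.Adj v i <;>
      simp [binAdj, SimpleGraph.adjMatrix_apply, hi, CharTwo.add_self_eq_zero]
  · by_cases hi : K.Adj v i <;> by_cases hj : K.Adj v j <;> by_cases h : K.Adj i j <;>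
      simp [binAdj, SimpleGraph.adjMatrix_apply, localComplement, hi, hj, h, hij,
        CharTwo.add_self_eq_zero]

theorem binAdj_localComplement_left (K : SimpleGraph (Fin n)) (v i : Fin n) :
    binAdj (localComplement K v) v i = binAdj K v i := by
  simp [binAdj_localComplement]

theorem localComplement_localComplement (K : SimpleGraph (Fin n)) (v : Fin n) :
    localComplement (localComplement K v) v = K := by
  refine binAdj_injective (Matrix.ext fun i j => ?_)
  rw [binAdj_localComplement, binAdj_localComplement]
  simp only [binAdj_localComplement_left]
  grind

theorem edgeForm_localComplement (K : SimpleGraph (Fin n)) (v : Fin n) (x : Fin n → ZMod 2) :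
    edgeForm (localComplement K v) x = edgeForm K x + edgeForm ⊤ fun i => binAdj K v i * x i := by
  let D := Matrix.diagonal (binAdj K v)
  have hD (x : Fin n → ZMod 2) : (fun i => binAdj K v i * x i) = D *ᵥ x :=
    funext fun i => (Matrix.mulVec_diagonal _ x i).symm
  have hbin : binAdj (localComplement K v) = binAdj K + D * binAdj ⊤ * D := by
    ext i j
    rw [binAdj_localComplement, Matrix.add_apply, Matrix.mul_diagonal, Matrix.diagonal_mul]
    rcases eq_or_ne i j with rfl | hij
    · rcases zmod_two_cases (binAdj K v i) with h | h <;> simp [h, CharTwo.add_self_eq_zero]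
    · rw [(binAdj_eq_one_iff (K := ⊤)).mpr hij, if_neg hij, mul_one, add_zero]
  rw [hD]
  refine (congrFun (eq_edgeForm (q := fun x => edgeForm K x + edgeForm ⊤ (D *ᵥ x))
    (fun x y => ?_) fun i a => ?_) x).symm
  · have hpolar : (D *ᵥ y) ⬝ᵥ binAdj ⊤ *ᵥ (D *ᵥ x) = y ⬝ᵥ (D * binAdj ⊤ * D) *ᵥ x := by
      rw [← Matrix.mulVec_mulVec, ← Matrix.mulVec_mulVec, Matrix.dotProduct_mulVec y,
        ← Matrix.mulVec_transpose, Matrix.diagonal_transpose]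
    simp only [hbin, Matrix.mulVec_add, edgeForm_add, Matrix.add_mulVec, dotProduct_add, hpolar]
    ring
  · rw [Matrix.diagonal_mulVec_single, edgeForm_single, edgeForm_single, add_zero]

end LocalComplement

section GraphState

theorem addChar_sum {ι A M : Type*} [AddCommMonoid A] [CommMonoid M] (ψ : AddChar A M)
    (s : Finset ι) (g : ι → A) : ψ (∑ i ∈ s, g i) = ∏ i ∈ s, ψ (g i) :=
  map_prod ψ.toMonoidHom (fun i => Multiplicative.ofAdd (g i)) s

variable {V : Type*} [Fintype V] [LinearOrder V]

/-- The graph state of `K`, without the factor that makes it a unit vector. -/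
noncomputable def graphState (K : SimpleGraph V) (x : V → ZMod 2) : ℂ :=
  signChar (edgeForm K x)

theorem productSpectrum_graphState_map (K : SimpleGraph V) (π : Equiv.Perm V) :
    productSpectrum (graphState (K.map π.toEmbedding)) = productSpectrum (graphState K) := by
  rw [← productSpectrum_comp_perm (graphState K) π]
  congr 1
  ext x
  rw [graphState, edgeForm_map, graphState]

theorem graphState_update (K : SimpleGraph V) (x : V → ZMod 2) (v : V) (b : ZMod 2) :
    graphState K (Function.update x v (x v + b)) =
      graphState K x * signChar (b * (binAdj K *ᵥ x) v) := by
  have hx : Function.update x v (x v + b) = x + Pi.single v b := by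
    ext i
    rcases eq_or_ne i v with rfl | hi <;> simp [*]
  rw [hx, graphState, edgeForm_add, edgeForm_single, add_zero, single_dotProduct,
    AddChar.map_add_eq_mul, graphState]

variable {n : ℕ}

theorem productSpectrum_eq_of_corresponds {f : (Fin n → ZMod 2) → ZMod 2} {K : SimpleGraph (Fin n)}
    (hf : Corresponds f K) :
    productSpectrum (fun x => signChar (f x)) = productSpectrum (graphState K) := by
  obtain ⟨b, c, hbc⟩ := hf
  let d : Fin n → ZMod 2 → ℂ := fun i a => signChar (b i * a)
  have hf : (fun x => signChar (f x)) =
      signChar c • fun x => productVector d x * graphState K x := by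
    ext x
    rw [hbc, ← edgeForm_eq_sum_filter, AddChar.map_add_eq_mul, AddChar.map_add_eq_mul,
      addChar_sum, Pi.smul_apply, smul_eq_mul, graphState, productVector]
    ring
  rw [hf, productSpectrum_smul (signChar.norm_apply c),
    productSpectrum_productVector_mul fun i a => signChar.norm_apply _]

end GraphState

section LocalComplementState

variable {n : ℕ}

/-- A square root of the bit flip; applied at a vertex, it realises the local complementation of a
graph state up to phases. -/
noncomputable def sqrtNot : Matrix (ZMod 2) (ZMod 2) ℂ :=
  Matrix.of fun r c => if r = c then (1 - Complex.I) / 2 else (1 + Complex.I) / 2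

theorem sqrtNot_mem_unitaryGroup : sqrtNot ∈ Matrix.unitaryGroup (ZMod 2) ℂ := by
  rw [Matrix.mem_unitaryGroup_iff]
  ext r c
  rcases zmod_two_cases r with rfl | rfl <;> rcases zmod_two_cases c with rfl | rfl <;>
    simp [Matrix.mul_apply, sum_zmod_two, sqrtNot, Matrix.star_apply, map_ofNat] <;>
    grind [Complex.I_sq]

theorem tensor_update_sqrtNot_mulVec_graphState (K : SimpleGraph (Fin n)) (v : Fin n)
    (x : Fin n → ZMod 2) :
    (tensor (Function.update 1 v sqrtNot) *ᵥ graphState K) x =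
      (-Complex.I) ^ ((binAdj K *ᵥ x) v).val * graphState K x := by
  rw [tensor_update_one_mulVec, ← Equiv.sum_comp (Equiv.addLeft (x v))]
  simp only [Equiv.coe_addLeft, graphState_update, sum_zmod_two, sqrtNot]
  rcases zmod_two_cases ((binAdj K *ᵥ x) v) with h | h <;>
    simp [h, signChar_apply, ZMod.val_one] <;> ring

theorem I_pow_val_add (a b : ZMod 2) :
    Complex.I ^ (a + b).val = signChar (a * b) * (Complex.I ^ a.val * Complex.I ^ b.val) := by
  rcases zmod_two_cases a with rfl | rfl <;> rcases zmod_two_cases b with rfl | rfl <;>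
    simp [signChar_apply, ZMod.val_one, CharTwo.add_self_eq_zero]

theorem edgeForm_top_succ (y : Fin (n + 1) → ZMod 2) :
    edgeForm ⊤ y = y 0 * ∑ i : Fin n, y i.succ + edgeForm ⊤ fun i : Fin n => y i.succ := by
  simp [edgeForm, upperAdj, binAdj, dotProduct, Matrix.mulVec, Fin.sum_univ_succ,
    (Fin.succ_ne_zero _).symm]

theorem signChar_edgeForm_top_mul_prod (y : Fin n → ZMod 2) :
    signChar (edgeForm ⊤ y) * ∏ i, Complex.I ^ (y i).val = Complex.I ^ (∑ i, y i).val := by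
  induction n with
  | zero => simp [edgeForm]
  | succ n ih =>
    rw [edgeForm_top_succ, Fin.prod_univ_succ, Fin.sum_univ_succ, I_pow_val_add,
      AddChar.map_add_eq_mul, ← ih fun i => y i.succ]
    ring

theorem graphState_localComplement (K : SimpleGraph (Fin n)) (v : Fin n) :
    graphState (localComplement K v) = fun x =>
      productVector (fun i b => Complex.I ^ (binAdj K v i * b).val) x *
        (tensor (Function.update 1 v sqrtNot) *ᵥ graphState K) x := by
  ext x
  have hphase : signChar (edgeForm ⊤ fun i => binAdj K v i * x i) *
      ∏ i, Complex.I ^ (binAdj K v i * x i).val = Complex.I ^ ((binAdj K *ᵥ x) v).val :=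
    signChar_edgeForm_top_mul_prod _
  have hcancel (k : ℕ) : Complex.I ^ k * (-Complex.I) ^ k = 1 := by
    rw [← mul_pow, mul_neg, Complex.I_mul_I, neg_neg, one_pow]
  have hsign (a : ZMod 2) : signChar a * signChar a = 1 := by
    rw [← AddChar.map_add_eq_mul, CharTwo.add_self_eq_zero, AddChar.map_zero_eq_one]
  rw [tensor_update_sqrtNot_mulVec_graphState, graphState, edgeForm_localComplement,
    AddChar.map_add_eq_mul, graphState, productVector]
  set q := signChar (edgeForm K x)
  set e := signChar (edgeForm ⊤ fun i => binAdj K v i * x i)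
  set D := ∏ i, Complex.I ^ (binAdj K v i * x i).val
  set k := ((binAdj K *ᵥ x) v).val
  calc q * e = q * e * (Complex.I ^ k * (-Complex.I) ^ k) := by rw [hcancel, mul_one]
    _ = (e * e) * D * ((-Complex.I) ^ k * q) := by rw [← hphase]; ring
    _ = D * ((-Complex.I) ^ k * q) := by rw [hsign, one_mul]

theorem productSpectrum_graphState_localComplement (K : SimpleGraph (Fin n)) (v : Fin n) :
    productSpectrum (graphState (localComplement K v)) = productSpectrum (graphState K) := by
  rw [graphState_localComplement, productSpectrum_productVector_mul fun i a => by simp,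
    productSpectrum_tensor_mulVec]
  intro i
  rcases eq_or_ne i v with rfl | hi
  · rw [Function.update_self]
    exact sqrtNot_mem_unitaryGroup
  · rw [Function.update_of_ne hi]
    exact one_mem _

theorem productSpectrum_eq_of_mem_lcOrbit {G K : SimpleGraph (Fin n)} (hK : K ∈ lcOrbit G) :
    productSpectrum (graphState K) = productSpectrum (graphState G) := by
  induction hK using Relation.ReflTransGen.head_induction_on with
  | refl => rfl
  | head hstep _ ih =>
    rw [← ih]
    rcases hstep with ⟨v, rfl⟩ | ⟨π, rfl⟩
    · exact (productSpectrum_graphState_localComplement _ v).symm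
    · exact (productSpectrum_graphState_map _ π).symm

theorem localComplement_mem_lcOrbit {G K : SimpleGraph (Fin n)} (hK : K ∈ lcOrbit G) (v : Fin n) :
    localComplement K v ∈ lcOrbit G :=
  Relation.ReflTransGen.head (Or.inl ⟨v, (localComplement_localComplement K v).symm⟩) hK

end LocalComplementState

section LowerBound

variable {V : Type*} [Fintype V] [LinearOrder V]

theorem two_pow_card_mem_productSpectrum {K : SimpleGraph V} {T : Finset V}
    (hT : K.IsIndepSet (T : Set V)) : (2 : ℝ) ^ #T ∈ productSpectrum (graphState K) := by
  let v : V → ZMod 2 → ℂ := fun i =>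
    if i ∈ T then fun _ => ((√2 : ℝ) : ℂ)⁻¹ else Pi.single 0 1
  have hv (i : V) : IsUnitVec (v i) := by
    by_cases hi : i ∈ T <;> norm_num [v, hi, IsUnitVec, sum_zmod_two]
  have hsum (i : V) : ∑ a, v i a = if i ∈ T then ((√2 : ℝ) : ℂ) else 1 := by
    by_cases hi : i ∈ T
    · have hsq : ((√2 : ℝ) : ℂ) * ((√2 : ℝ) : ℂ) = 2 := by
        rw [← Complex.ofReal_mul, Real.mul_self_sqrt zero_le_two, Complex.ofReal_ofNat]
      have hne : ((√2 : ℝ) : ℂ) ≠ 0 := by simp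
      simp only [v, if_pos hi, sum_zmod_two]
      rw [← two_mul, ← hsq, mul_inv_cancel_right₀ hne]
    · simp [v, hi]
  have hterm (x : V → ZMod 2) : productVector v x * graphState K x = productVector v x := by
    by_cases hx : Function.support x ⊆ T
    · rw [graphState, edgeForm_eq_zero (Set.Pairwise.mono hx hT), AddChar.map_zero_eq_one, mul_one]
    · obtain ⟨i, hi, hiT⟩ := Set.not_subset.mp hx
      have hzero : productVector v x = 0 := by
        refine Finset.prod_eq_zero (Finset.mem_univ i) ?_
        simp only [v, if_neg (mt Finset.mem_coe.mpr hiT)]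
        exact Pi.single_eq_of_ne hi 1
      rw [hzero, zero_mul]
  refine ⟨v, hv, ?_⟩
  simp only [dotProduct, hterm, sum_productVector, hsum, Finset.prod_ite_mem, Finset.univ_inter,
    Finset.prod_const, norm_pow]
  rw [Complex.norm_real, Real.norm_of_nonneg (Real.sqrt_nonneg 2), ← pow_mul, mul_comm, pow_mul,
    Real.sq_sqrt zero_le_two]

theorem two_pow_indepNum_mem_productSpectrum (K : SimpleGraph V) :
    (2 : ℝ) ^ K.indepNum ∈ productSpectrum (graphState K) := by
  obtain ⟨T, hT⟩ := K.exists_isNIndepSet_indepNum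
  exact hT.card_eq ▸ two_pow_card_mem_productSpectrum hT.isIndepSet

end LowerBound

section Code

theorem sum_comp_le_card_ker_mul_sum {G H : Type*} [AddGroup G] [AddGroup H] [Fintype G]
    [Fintype H] (φ : G →+ H) {g : H → ℝ} (hg : ∀ z, 0 ≤ g z) :
    ∑ x, g (φ x) ≤ Nat.card φ.ker * ∑ z, g z := by
  classical
  have hfiber (z : H) : #{x | φ x = z} ≤ Nat.card φ.ker := by
    by_cases hz : ∃ x, φ x = z
    · obtain ⟨x, rfl⟩ := hz
      rw [← Nat.card_congr (φ.fiberEquivKer x), Nat.card_eq_fintype_card,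
        Fintype.card_of_subtype {y | φ y = φ x} (by simp)]
    · rw [Finset.filter_false_of_mem fun x _ hx => hz ⟨x, hx⟩]
      exact Nat.zero_le _
  calc ∑ x, g (φ x) = ∑ z, ∑ x with φ x = z, g (φ x) :=
        (Finset.sum_fiberwise _ _ _).symm
    _ = ∑ z, (#{x | φ x = z} : ℝ) * g z := by
        refine Finset.sum_congr rfl fun z _ => ?_
        rw [Finset.sum_congr rfl fun x hx => by rw [(Finset.mem_filter.mp hx).2],
          Finset.sum_const, nsmul_eq_mul]
    _ ≤ _ := by
        rw [Finset.mul_sum]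
        gcongr with z
        · exact hg z
        · exact hfiber z

variable {F ι : Type*} [Field F]

/-- The shortened code: the codewords of `C` that vanish on `A`, kept at full length. -/
def shortening (C : Submodule F (ι → F)) (A : Finset ι) : Submodule F C :=
  LinearMap.ker (LinearMap.funLeft F F ((↑) : A → ι) ∘ₗ C.subtype)

theorem mem_shortening {C : Submodule F (ι → F)} {A : Finset ι} {c : C} :
    c ∈ shortening C A ↔ ∀ i ∈ A, (c : ι → F) i = 0 := by
  simp [shortening, funext_iff, LinearMap.funLeft_apply]

theorem finrank_shortening_supermodular [Finite ι] [DecidableEq ι] (C : Submodule F (ι → F))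
    (A B : Finset ι) :
    Module.finrank F (shortening C A) + Module.finrank F (shortening C B) ≤
      Module.finrank F (shortening C (A ∪ B)) + Module.finrank F (shortening C (A ∩ B)) := by
  have hunion : shortening C (A ∪ B) = shortening C A ⊓ shortening C B := by
    ext c
    simp only [mem_shortening, Submodule.mem_inf, Finset.mem_union, or_imp, forall_and]
  have hinter : shortening C A ⊔ shortening C B ≤ shortening C (A ∩ B) :=
    sup_le (fun c hc => mem_shortening.mpr fun i hi =>
        mem_shortening.mp hc i (Finset.mem_of_mem_inter_left hi))
      fun c hc => mem_shortening.mpr fun i hi =>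
        mem_shortening.mp hc i (Finset.mem_of_mem_inter_right hi)
  rw [← Submodule.finrank_sup_add_finrank_inf_eq, hunion, add_comm]
  gcongr
  exact Submodule.finrank_mono hinter

variable [Fintype F]

theorem sum_code_prod_le (C : Submodule F (ι → F)) [Fintype C] (S : Finset ι) {g : ι → F → ℝ}
    (hg : ∀ i a, 0 ≤ g i a) :
    ∑ c : C, ∏ i ∈ S, g i ((c : ι → F) i) ≤
      Fintype.card F ^ Module.finrank F (shortening C S) * ∏ i ∈ S, ∑ a, g i a := by
  classical
  have hcard : Nat.card (shortening C S) =
      Fintype.card F ^ Module.finrank F (shortening C S) := by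
    rw [Nat.card_eq_fintype_card, Module.card_eq_pow_finrank (K := F)]
  have hsum := sum_comp_le_card_ker_mul_sum
    (LinearMap.funLeft F F ((↑) : S → ι) ∘ₗ C.subtype).toAddMonoidHom
    (g := fun z => ∏ i : S, g i (z i)) fun z => Finset.prod_nonneg fun i _ => hg i _
  rw [← Finset.prod_coe_sort S fun i => ∑ a, g i a, Finset.prod_univ_sum, Fintype.piFinset_univ,
    ← Nat.cast_pow, ← hcard]
  simp only [← Finset.prod_coe_sort S]
  exact hsum

variable [Fintype ι] [DecidableEq ι]

theorem norm_sum_code_sq_le (C : Submodule F (ι → F)) [Fintype C] (S : Finset ι)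
    (v : ι → F → ℂ) :
    ‖∑ c : C, productVector v c‖ ^ 2 ≤
      Fintype.card F ^ (Module.finrank F (shortening C S) + Module.finrank F (shortening C Sᶜ)) *
        ∏ i, ∑ a, ‖v i a‖ ^ 2 := by
  let p (T : Finset ι) (c : C) : ℝ := ∏ i ∈ T, ‖v i ((c : ι → F) i)‖
  have hp (T : Finset ι) : ∑ c, p T c ^ 2 ≤
      Fintype.card F ^ Module.finrank F (shortening C T) * ∏ i ∈ T, ∑ a, ‖v i a‖ ^ 2 := by
    simp only [p, ← Finset.prod_pow]
    exact sum_code_prod_le C T fun i a => sq_nonneg ‖v i a‖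
  calc ‖∑ c : C, productVector v c‖ ^ 2
      ≤ (∑ c, p S c * p Sᶜ c) ^ 2 := by
        gcongr
        refine (norm_sum_le _ _).trans_eq (Finset.sum_congr rfl fun c _ => ?_)
        rw [Finset.prod_mul_prod_compl, productVector, norm_prod]
    _ ≤ (∑ c, p S c ^ 2) * ∑ c, p Sᶜ c ^ 2 := Finset.sum_mul_sq_le_sq_mul_sq _ _ _
    _ ≤ _ := mul_le_mul (hp S) (hp Sᶜ) (by positivity) (by positivity)
    _ = _ := by
        rw [mul_mul_mul_comm, ← pow_add, Finset.prod_mul_prod_compl]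

end Code

section MinMax

variable {α : Type*} [DecidableEq α]

theorem card_sdiff_union_add_card_sdiff_inter (J A B : Finset α) :
    #(J \ (A ∪ B)) + #(J \ (A ∩ B)) = #(J \ A) + #(J \ B) := by
  rw [Finset.sdiff_union_distrib, Finset.sdiff_inter_distrib_right, add_comm,
    Finset.card_union_add_card_inter]

theorem exists_le_add_sdiff {r₁ r₂ : Finset α → ℤ}
    (h₁ : ∀ A B, r₁ (A ∪ B) + r₁ (A ∩ B) ≤ r₁ A + r₁ B)
    (h₂ : ∀ A B, r₂ (A ∪ B) + r₂ (A ∩ B) ≤ r₂ A + r₂ B) (t : ℤ) (J : Finset α)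
    (ht : ∀ A ⊆ J, t ≤ #(J \ A) + r₁ A + r₂ A) :
    ∃ T ⊆ J, t ≤ r₁ T + r₂ (J \ T) := by
  induction J using Finset.induction_on generalizing r₁ r₂ with
  | empty => exact ⟨∅, subset_rfl, by simpa using ht ∅ subset_rfl⟩
  | insert e J he ih =>
    have hinsert {r : Finset α → ℤ} (h : ∀ A B, r (A ∪ B) + r (A ∩ B) ≤ r A + r B)
        (A B : Finset α) : r (insert e (A ∪ B)) + r (insert e (A ∩ B)) ≤
          r (insert e A) + r (insert e B) := by
      rw [Finset.insert_union_distrib, Finset.insert_inter_distrib]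
      exact h _ _
    by_cases ht₁ : ∀ A ⊆ J, t ≤ #(J \ A) + r₁ (insert e A) + r₂ A
    · obtain ⟨T, hT, h⟩ := ih (hinsert h₁) h₂ ht₁
      refine ⟨insert e T, Finset.insert_subset_insert e hT, ?_⟩
      rwa [Finset.insert_sdiff_insert, Finset.sdiff_insert_of_notMem he]
    by_cases ht₂ : ∀ A ⊆ J, t ≤ #(J \ A) + r₁ A + r₂ (insert e A)
    · obtain ⟨T, hT, h⟩ := ih h₁ (hinsert h₂) ht₂
      refine ⟨T, hT.trans (Finset.subset_insert e J), ?_⟩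
      rwa [Finset.insert_sdiff_of_notMem _ fun h => he (hT h)]
    -- Violations `A` and `B` of the two contracted conditions are uncrossed: by submodularity the
    -- original condition fails at `insert e (A ∪ B)` or at `A ∩ B`.
    push Not at ht₁ ht₂
    obtain ⟨A, hA, hrA⟩ := ht₁
    obtain ⟨B, hB, hrB⟩ := ht₂
    have heA : e ∉ A := fun h => he (hA h)
    have heB : e ∉ B := fun h => he (hB h)
    have hunion := ht (insert e (A ∪ B)) (Finset.insert_subset_insert e (Finset.union_subset hA hB))
    have hinter := ht (A ∩ B) ((Finset.inter_subset_left.trans hA).trans (Finset.subset_insert e J))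
    rw [Finset.insert_sdiff_insert, Finset.sdiff_insert_of_notMem he] at hunion
    rw [Finset.insert_sdiff_of_notMem _ fun h => heA (Finset.mem_inter.mp h).1,
      Finset.card_insert_of_notMem fun h => he (Finset.mem_sdiff.mp h).1] at hinter
    have hcard := card_sdiff_union_add_card_sdiff_inter J A B
    have hsub₁ := h₁ (insert e A) B
    have hsub₂ := h₂ A (insert e B)
    rw [Finset.insert_union, Finset.insert_inter_of_notMem heB] at hsub₁
    rw [Finset.union_insert, Finset.inter_insert_of_notMem heA] at hsub₂
    push_cast at hinter
    omega

theorem exists_add_compl_le [Fintype α] {d : Finset α → ℕ}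
    (hd : ∀ A B, d A + d B ≤ d (A ∪ B) + d (A ∩ B)) :
    ∃ I S, d S + d Sᶜ + #Iᶜ ≤ 2 * d I := by
  have hsub (A B : Finset α) : -(d (A ∪ B) : ℤ) + -(d (A ∩ B) : ℤ) ≤ -(d A : ℤ) + -(d B : ℤ) := by
    have := hd A B
    omega
  obtain ⟨I, -, hI⟩ := Finset.exists_min_image Finset.univ
    (fun A : Finset α => (#Aᶜ : ℤ) - 2 * d A) Finset.univ_nonempty
  obtain ⟨S, -, hS⟩ := exists_le_add_sdiff hsub hsub (#Iᶜ - 2 * d I) Finset.univ fun A _ => by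
    have := hI A (Finset.mem_univ A)
    rw [← Finset.compl_eq_univ_sdiff]
    omega
  rw [← Finset.compl_eq_univ_sdiff] at hS
  exact ⟨I, S, by omega⟩

end MinMax

section ClosedNeighborhood

variable {V : Type*} [DecidableEq V]

/-- The closed neighbourhood matrix over the field with two elements, on which pivoting acts by a
bilinear formula. -/
noncomputable def closedAdj (K : SimpleGraph V) : Matrix V V (ZMod 2) :=
  binAdj K + 1

theorem closedAdj_comm (K : SimpleGraph V) (i j : V) : closedAdj K i j = closedAdj K j i := by
  simp only [closedAdj, Matrix.add_apply, binAdj_comm K i j, Matrix.one_apply, eq_comm (a := i)]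

theorem closedAdj_self (K : SimpleGraph V) (i : V) : closedAdj K i i = 1 := by
  simp [closedAdj]

theorem closedAdj_injective : Function.Injective (closedAdj : SimpleGraph V → _) := fun _ _ h =>
  binAdj_injective (add_right_cancel h)

theorem closedAdj_of_adj {K : SimpleGraph V} {i j : V} (h : K.Adj i j) : closedAdj K i j = 1 := by
  simp [closedAdj, binAdj_eq_one_iff.mpr h, h.ne]

theorem isIndepSet_iff_closedAdj {K : SimpleGraph V} {s : Set V} :
    K.IsIndepSet s ↔ s.Pairwise fun i j => closedAdj K i j = 0 := by
  refine forall₂_congr fun i _ => forall₃_congr fun j _ hij => ?_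
  simp only [closedAdj, Matrix.add_apply, Matrix.one_apply_ne hij, add_zero, binAdj_eq_zero_iff]

end ClosedNeighborhood

section Pivot

variable {n : ℕ} {B : SimpleGraph (Fin n)} {u v : Fin n}

/-- The pivot of `B` on the edge `uv`: it makes `u` and `v` exchange their closed neighbourhoods
and, in a bipartite graph, their sides. -/
def pivot (B : SimpleGraph (Fin n)) (u v : Fin n) : SimpleGraph (Fin n) :=
  localComplement (localComplement (localComplement B u) v) u

theorem pivot_mem_lcOrbit {G : SimpleGraph (Fin n)} (hB : B ∈ lcOrbit G) (u v : Fin n) :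
    pivot B u v ∈ lcOrbit G :=
  localComplement_mem_lcOrbit (localComplement_mem_lcOrbit (localComplement_mem_lcOrbit hB u) v) u

theorem closedAdj_pivot (huv : B.Adj u v) (i j : Fin n) :
    closedAdj (pivot B u v) i j =
      closedAdj B i j + closedAdj B u i * closedAdj B v j + closedAdj B v i * closedAdj B u j := by
  have hone : binAdj B u v = 1 := binAdj_eq_one_iff.mpr huv
  have hrow₁ (k : Fin n) : binAdj (localComplement B u) v k =
      binAdj B v k + binAdj B u k + if v = k then 1 else 0 := by
    rw [binAdj_localComplement, hone, one_mul]
  have hrow₂ (k : Fin n) : binAdj (localComplement (localComplement B u) v) u k =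
      binAdj B v k + (if v = k then 1 else 0) + if u = k then 1 else 0 := by
    rw [binAdj_localComplement, binAdj_localComplement_left, hrow₁ u, hrow₁ k, binAdj_comm B v u,
      hone, binAdj_self, if_neg huv.ne']
    grind
  simp only [closedAdj, Matrix.add_apply, Matrix.one_apply, pivot]
  rw [binAdj_localComplement, hrow₂, hrow₂, binAdj_localComplement, hrow₁, hrow₁,
    binAdj_localComplement]
  grind

theorem pivot_comm (huv : B.Adj u v) : pivot B u v = pivot B v u :=
  closedAdj_injective <| Matrix.ext fun i j => by
    rw [closedAdj_pivot huv, closedAdj_pivot huv.symm, add_right_comm]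

theorem isIndepSet_pivot {s : Set (Fin n)} (hs : B.IsIndepSet s) (huv : B.Adj u v) (hu : u ∈ s) :
    (pivot B u v).IsIndepSet (insert v (s \ {u})) := by
  rw [isIndepSet_iff_closedAdj] at hs ⊢
  have hzero {i : Fin n} (hi : i ∈ s \ {u}) : closedAdj B u i = 0 :=
    hs hu hi.1 (Ne.symm hi.2)
  have : Std.Symm fun i j => closedAdj (pivot B u v) i j = 0 :=
    ⟨fun i j h => (closedAdj_comm _ j i).trans h⟩
  rw [Set.pairwise_insert_of_symm]
  refine ⟨fun i hi j hj hij => ?_, fun j hj _ => ?_⟩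
  · change closedAdj (pivot B u v) i j = 0
    rw [closedAdj_pivot huv, hs hi.1 hj.1 hij, hzero hi, hzero hj]
    ring
  · rw [closedAdj_pivot huv, hzero hj, closedAdj_of_adj huv]
    grind

theorem isBipartiteWith_compl_iff {V : Type*} {K : SimpleGraph V} {s : Set V} :
    K.IsBipartiteWith s sᶜ ↔ K.IsIndepSet s ∧ K.IsIndepSet sᶜ := by
  refine ⟨fun h => ⟨fun i hi j hj _ hij => h.mem_of_mem_adj hi hij hj,
    fun i hi j hj _ hij => hj (h.symm.mem_of_mem_adj hi hij)⟩, fun ⟨hs, hs'⟩ =>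
      ⟨disjoint_compl_right, fun i j hij => ?_⟩⟩
  by_cases hi : i ∈ s
  · exact Or.inl ⟨hi, fun hj => hs hi hj hij.ne hij⟩
  · exact Or.inr ⟨hi, not_not.mp fun hj => hs' hi hj hij.ne hij⟩

theorem isBipartiteWith_pivot {s : Set (Fin n)} (hs : B.IsBipartiteWith s sᶜ) (huv : B.Adj u v)
    (hu : u ∈ s) :
    (pivot B u v).IsBipartiteWith (insert v (s \ {u})) (insert v (s \ {u}))ᶜ := by
  have hv : v ∈ sᶜ := hs.mem_of_mem_adj hu huv
  obtain ⟨hindep, hindep'⟩ := isBipartiteWith_compl_iff.mp hs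
  have hcompl : (insert v (s \ {u}))ᶜ = insert u (sᶜ \ {v}) := by
    ext i
    simp only [Set.mem_compl_iff, Set.mem_insert_iff, Set.mem_sdiff, Set.mem_singleton_iff]
    grind
  refine isBipartiteWith_compl_iff.mpr ⟨isIndepSet_pivot hindep huv hu, ?_⟩
  rw [hcompl, pivot_comm huv]
  exact isIndepSet_pivot hindep' huv.symm hv

end Pivot

section BipartiteCode

variable {V : Type*} [Fintype V]

theorem binAdj_mulVec_congr {K : SimpleGraph V} {X : Finset V} (hX : K.IsIndepSet (X : Set V)ᶜ)
    {c d : V → ZMod 2} (hcd : ∀ i ∈ X, c i = d i) {y : V} (hy : y ∉ X) :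
    (binAdj K *ᵥ c) y = (binAdj K *ᵥ d) y := by
  simp only [Matrix.mulVec, dotProduct]
  refine Finset.sum_congr rfl fun i _ => ?_
  by_cases hi : i ∈ X
  · rw [hcd i hi]
  · rw [binAdj_eq_zero_iff.mpr fun h => hX hy hi h.ne h, zero_mul, zero_mul]

variable [DecidableEq V]

/-- The code cut out by the closed neighbourhoods of the vertices outside `X`. When `X` is one side
of a bipartite graph, a codeword is given by arbitrary values on `X`, extended to every other vertex
by the sum over its neighbours. -/
def closedNeighborCode (K : SimpleGraph V) (X : Finset V) : Submodule (ZMod 2) (V → ZMod 2) where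
  carrier := {c | ∀ y ∉ X, (closedAdj K *ᵥ c) y = 0}
  add_mem' hc hd y hy := by rw [Matrix.mulVec_add, Pi.add_apply, hc y hy, hd y hy, add_zero]
  zero_mem' y _ := by rw [Matrix.mulVec_zero, Pi.zero_apply]
  smul_mem' a c hc y hy := by rw [Matrix.mulVec_smul, Pi.smul_apply, hc y hy, smul_zero]

theorem mem_closedNeighborCode {K : SimpleGraph V} {X : Finset V} {c : V → ZMod 2} :
    c ∈ closedNeighborCode K X ↔ ∀ y ∉ X, c y = (binAdj K *ᵥ c) y := by
  refine forall₂_congr fun y _ => ?_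
  rw [closedAdj, Matrix.add_mulVec, Matrix.one_mulVec, Pi.add_apply, CharTwo.add_eq_zero, eq_comm]

theorem closedNeighborCode_pivot {n : ℕ} {B : SimpleGraph (Fin n)} {X : Finset (Fin n)}
    {u v : Fin n} (hX : B.IsIndepSet (X : Set (Fin n))ᶜ) (huv : B.Adj u v) (hu : u ∈ X)
    (hv : v ∉ X) :
    closedNeighborCode (pivot B u v) (insert v (X.erase u)) = closedNeighborCode B X := by
  ext c
  have hrow (y : Fin n) : (closedAdj (pivot B u v) *ᵥ c) y = (closedAdj B *ᵥ c) y +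
      closedAdj B u y * (closedAdj B *ᵥ c) v + closedAdj B v y * (closedAdj B *ᵥ c) u := by
    simp only [Matrix.mulVec, dotProduct, closedAdj_pivot huv, add_mul, Finset.sum_add_distrib,
      Finset.mul_sum, mul_assoc]
  have hrow_u : (closedAdj (pivot B u v) *ᵥ c) u = (closedAdj B *ᵥ c) v := by
    rw [hrow, closedAdj_self, closedAdj_of_adj huv.symm]
    grind
  have hrow_of_ne {y : Fin n} (hy : y ∉ X) (hyv : y ≠ v) : (closedAdj (pivot B u v) *ᵥ c) y =
      (closedAdj B *ᵥ c) y + closedAdj B u y * (closedAdj B *ᵥ c) v := by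
    rw [hrow, isIndepSet_iff_closedAdj.mp hX hv hy hyv.symm, zero_mul, add_zero]
  have hmem (y : Fin n) : y ∉ insert v (X.erase u) ↔ y = u ∨ y ∉ X ∧ y ≠ v := by
    simp only [Finset.mem_insert, Finset.mem_erase]
    grind
  calc c ∈ closedNeighborCode (pivot B u v) (insert v (X.erase u))
      ↔ (closedAdj B *ᵥ c) v = 0 ∧
          ∀ y ∉ X, y ≠ v → (closedAdj (pivot B u v) *ᵥ c) y = 0 := by
        rw [← hrow_u]
        exact ⟨fun h => ⟨h u ((hmem u).mpr (Or.inl rfl)),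
          fun y hy hyv => h y ((hmem y).mpr (Or.inr ⟨hy, hyv⟩))⟩,
          fun h y hy => ((hmem y).mp hy).elim (fun hyu => hyu ▸ h.1) fun hy => h.2 y hy.1 hy.2⟩
    _ ↔ (closedAdj B *ᵥ c) v = 0 ∧ ∀ y ∉ X, y ≠ v → (closedAdj B *ᵥ c) y = 0 := by
        refine and_congr_right fun h => forall₃_congr fun y hy hyv => ?_
        rw [hrow_of_ne hy hyv, h, mul_zero, add_zero]
    _ ↔ c ∈ closedNeighborCode B X :=
        ⟨fun h y hy => (eq_or_ne y v).elim (fun hyv => hyv ▸ h.1) (h.2 y hy),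
          fun h => ⟨h v hv, fun y hy _ => h y hy⟩⟩

theorem eq_of_mem_closedNeighborCode {K : SimpleGraph V} {X : Finset V}
    (hX : K.IsIndepSet (X : Set V)ᶜ) {c d : V → ZMod 2} (hc : c ∈ closedNeighborCode K X)
    (hd : d ∈ closedNeighborCode K X) (hcd : ∀ i ∈ X, c i = d i) : c = d := by
  ext i
  by_cases hi : i ∈ X
  · exact hcd i hi
  · rw [mem_closedNeighborCode.mp hc i hi, mem_closedNeighborCode.mp hd i hi,
      binAdj_mulVec_congr hX hcd hi]

theorem exists_mem_closedNeighborCode {K : SimpleGraph V} {X : Finset V}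
    (hX : K.IsIndepSet (X : Set V)ᶜ) (x : V → ZMod 2) :
    ∃ c ∈ closedNeighborCode K X, ∀ i ∈ X, c i = x i := by
  refine ⟨fun i => if i ∈ X then x i else (binAdj K *ᵥ x) i,
    mem_closedNeighborCode.mpr fun y hy => ?_, fun i hi => if_pos hi⟩
  rw [if_neg hy]
  exact binAdj_mulVec_congr hX (fun i hi => (if_pos hi).symm) hy

theorem finrank_shortening_closedNeighborCode_le {K : SimpleGraph V} {X : Finset V}
    (hX : K.IsIndepSet (X : Set V)ᶜ) (A : Finset V) :
    Module.finrank (ZMod 2) (shortening (closedNeighborCode K X) A) ≤ #(X \ A) := by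
  let res : shortening (closedNeighborCode K X) A →ₗ[ZMod 2] (X \ A : Finset V) → ZMod 2 :=
    LinearMap.funLeft (ZMod 2) (ZMod 2) (↑) ∘ₗ Submodule.subtype _ ∘ₗ Submodule.subtype _
  have hres : Function.Injective res := by
    refine LinearMap.ker_eq_bot.mp (LinearMap.ker_eq_bot'.mpr fun c hc => ?_)
    refine Subtype.ext (Subtype.ext ?_)
    refine eq_of_mem_closedNeighborCode hX c.1.2 (Submodule.zero_mem _) fun i hi => ?_
    by_cases hiA : i ∈ A
    · exact mem_shortening.mp c.2 i hiA
    · exact congrFun hc ⟨i, Finset.mem_sdiff.mpr ⟨hi, hiA⟩⟩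
  calc Module.finrank (ZMod 2) (shortening (closedNeighborCode K X) A)
      ≤ Module.finrank (ZMod 2) ((X \ A : Finset V) → ZMod 2) :=
        LinearMap.finrank_le_finrank_of_injective hres
    _ = #(X \ A) := by rw [Module.finrank_fintype_fun_eq_card, Fintype.card_coe]

end BipartiteCode

section BipartiteState

section SideMatrix

variable {V : Type*} [DecidableEq V]

/-- The matrices of signs that turn the indicator function of the code `closedNeighborCode K X` into
the graph state of `K`, for a bipartite graph `K` with side `X`. -/
noncomputable def sideMatrix (X : Finset V) (i : V) : Matrix (ZMod 2) (ZMod 2) ℂ :=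
  if i ∈ X then 1 else Matrix.of fun r c => signChar (r * c)

theorem sideMatrix_mul_star (X : Finset V) (i : V) :
    sideMatrix X i * star (sideMatrix X i) = ((if i ∈ X then 1 else 2 : ℝ) : ℂ) • 1 := by
  by_cases hi : i ∈ X
  · simp [sideMatrix, hi]
  · ext r c
    rcases zmod_two_cases r with rfl | rfl <;> rcases zmod_two_cases c with rfl | rfl <;>
      simp [sideMatrix, hi, Matrix.mul_apply, sum_zmod_two, signChar_apply, ZMod.val_one,
        one_add_one_eq_two]

end SideMatrix

variable {V : Type*} [Fintype V] [LinearOrder V] {K : SimpleGraph V} {X : Finset V}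

theorem edgeForm_of_isBipartiteWith (hK : K.IsBipartiteWith (X : Set V) (X : Set V)ᶜ)
    (x : V → ZMod 2) : edgeForm K x = ∑ i, if i ∈ X then 0 else x i * (binAdj K *ᵥ x) i := by
  obtain ⟨hX, hXc⟩ := isBipartiteWith_compl_iff.mp hK
  let x₁ : V → ZMod 2 := fun i => if i ∈ X then x i else 0
  let x₂ : V → ZMod 2 := fun i => if i ∈ X then 0 else x i
  have hx : x = x₁ + x₂ := by
    ext i
    by_cases hi : i ∈ X <;> simp [x₁, x₂, hi]
  have hsupp₁ : Function.support x₁ ⊆ X := fun i hi => by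
    by_contra h
    exact hi (if_neg h)
  have hsupp₂ : Function.support x₂ ⊆ (X : Set V)ᶜ := fun i hi h => hi (if_pos h)
  rw [hx, edgeForm_add, edgeForm_eq_zero (hX.mono hsupp₁), edgeForm_eq_zero (hXc.mono hsupp₂),
    zero_add, zero_add, ← hx]
  refine Finset.sum_congr rfl fun i _ => ?_
  by_cases hi : i ∈ X
  · simp only [x₂, if_pos hi, zero_mul]
  · simp only [x₂, if_neg hi]
    rw [binAdj_mulVec_congr hXc (fun j hj => if_pos hj) hi]

theorem graphState_eq_sum_closedNeighborCode (hK : K.IsBipartiteWith (X : Set V) (X : Set V)ᶜ)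
    [Fintype (closedNeighborCode K X)] (x : V → ZMod 2) :
    graphState K x = ∑ c : closedNeighborCode K X,
      ∏ i, sideMatrix X i (x i) ((c : V → ZMod 2) i) := by
  have hXc := (isBipartiteWith_compl_iff.mp hK).2
  obtain ⟨e, he, hex⟩ := exists_mem_closedNeighborCode hXc x
  rw [Finset.sum_eq_single (⟨e, he⟩ : closedNeighborCode K X)]
  · rw [graphState, edgeForm_of_isBipartiteWith hK, addChar_sum]
    refine Finset.prod_congr rfl fun i _ => ?_
    dsimp only
    by_cases hi : i ∈ X
    · rw [if_pos hi, sideMatrix, if_pos hi, hex i hi, Matrix.one_apply_eq,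
        AddChar.map_zero_eq_one]
    · rw [if_neg hi, sideMatrix, if_neg hi, Matrix.of_apply, mem_closedNeighborCode.mp he i hi,
        binAdj_mulVec_congr hXc hex hi]
  · intro c _ hce
    obtain ⟨i, hi, hne⟩ : ∃ i ∈ X, x i ≠ (c : V → ZMod 2) i := by
      by_contra! h
      exact hce (Subtype.ext (eq_of_mem_closedNeighborCode hXc c.2 he fun i hi =>
        (h i hi).symm.trans (hex i hi).symm))
    refine Finset.prod_eq_zero (Finset.mem_univ i) ?_
    rw [sideMatrix, if_pos hi, Matrix.one_apply_ne hne]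
  · exact fun h => absurd (Finset.mem_univ _) h

theorem productVector_dotProduct_graphState
    (hK : K.IsBipartiteWith (X : Set V) (X : Set V)ᶜ)
    [Fintype (closedNeighborCode K X)] (v : V → ZMod 2 → ℂ) :
    productVector v ⬝ᵥ graphState K =
      ∑ c : closedNeighborCode K X, productVector (fun i => v i ᵥ* sideMatrix X i) c := by
  simp only [dotProduct, graphState_eq_sum_closedNeighborCode hK, Finset.mul_sum]
  rw [Finset.sum_comm]
  refine Finset.sum_congr rfl fun c _ => ?_
  simp only [productVector, Matrix.vecMul, dotProduct, ← Finset.prod_mul_distrib]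
  exact sum_productVector fun i a => v i a * sideMatrix X i a ((c : V → ZMod 2) i)

theorem le_two_pow_of_mem_productSpectrum (hK : K.IsBipartiteWith (X : Set V) (X : Set V)ᶜ)
    (S : Finset V) {r : ℝ} (hr : r ∈ productSpectrum (graphState K)) :
    r ≤ 2 ^ (#Xᶜ + Module.finrank (ZMod 2) (shortening (closedNeighborCode K X) S) +
      Module.finrank (ZMod 2) (shortening (closedNeighborCode K X) Sᶜ)) := by
  classical
  obtain ⟨v, hv, rfl⟩ := hr
  have hside (i : V) :
      ∑ a, ‖(v i ᵥ* sideMatrix X i) a‖ ^ 2 = if i ∈ X then (1 : ℝ) else 2 := by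
    rw [sum_norm_sq_vecMul (sideMatrix_mul_star X i), hv i, mul_one]
  have hprod : ∏ i, ∑ a, ‖(v i ᵥ* sideMatrix X i) a‖ ^ 2 = (2 : ℝ) ^ #Xᶜ := by
    simp only [hside, Finset.prod_ite, Finset.prod_const, one_pow, one_mul]
    congr 2
    ext i
    simp
  rw [productVector_dotProduct_graphState hK]
  refine (norm_sum_code_sq_le _ S _).trans_eq ?_
  rw [hprod, ZMod.card, Nat.cast_ofNat]
  ring

end BipartiteState

section Maximum

theorem exists_isBipartiteWith_compl {V : Type*} [Finite V] {K : SimpleGraph V}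
    (hK : K.IsBipartite) : ∃ X : Finset V, K.IsBipartiteWith (X : Set V) (X : Set V)ᶜ := by
  obtain ⟨s, t, hst⟩ := hK.exists_isBipartiteWith
  have hts : t ⊆ sᶜ := hst.disjoint.subset_compl_left
  refine ⟨s.toFinite.toFinset, ?_⟩
  rw [Set.Finite.coe_toFinset]
  exact ⟨disjoint_compl_right, fun i j hij =>
    (hst.mem_of_adj hij).imp (And.imp_right (hts ·)) (And.imp_left (hts ·))⟩

variable {n : ℕ} {G B : SimpleGraph (Fin n)} {X : Finset (Fin n)}

theorem exists_isIndepSet_symmDiff (hB : B ∈ lcOrbit G)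
    (hX : B.IsBipartiteWith (X : Set (Fin n)) (X : Set (Fin n))ᶜ) (I : Finset (Fin n)) :
    ∃ K ∈ lcOrbit G, ∃ Y : Finset (Fin n), K.IsBipartiteWith (Y : Set (Fin n)) (Y : Set (Fin n))ᶜ ∧
      closedNeighborCode K Y = closedNeighborCode B X ∧ #Y = #X ∧
      K.IsIndepSet (symmDiff Y I : Finset (Fin n)) := by
  classical
  let P : Finset (Fin n) → Prop := fun Y => ∃ K ∈ lcOrbit G,
    K.IsBipartiteWith (Y : Set (Fin n)) (Y : Set (Fin n))ᶜ ∧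
      closedNeighborCode K Y = closedNeighborCode B X ∧ #Y = #X
  obtain ⟨Y, hPY, hmax⟩ := Finset.exists_max_image {Y | P Y} (fun Y => #(Y ∩ I))
    ⟨X, Finset.mem_filter.mpr ⟨Finset.mem_univ X, B, hB, hX, rfl, rfl⟩⟩
  obtain ⟨K, hK, hY, hcode, hcard⟩ := (Finset.mem_filter.mp hPY).2
  obtain ⟨hindep, hindep'⟩ := isBipartiteWith_compl_iff.mp hY
  have hcross {x y : Fin n} (hxY : x ∈ Y) (hxI : x ∉ I) (hyI : y ∈ I) (hyY : y ∉ Y) :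
      ¬K.Adj x y := by
    intro hxy
    have hP : P (insert y (Y.erase x)) := by
      refine ⟨pivot K x y, pivot_mem_lcOrbit hK x y, ?_, ?_, ?_⟩
      · simpa using isBipartiteWith_pivot hY hxy hxY
      · rw [closedNeighborCode_pivot hindep' hxy hxY hyY, hcode]
      · rw [Finset.card_insert_of_notMem fun h => hyY (Finset.mem_of_mem_erase h),
          Finset.card_erase_add_one hxY, hcard]
    have hle := hmax _ (Finset.mem_filter.mpr ⟨Finset.mem_univ _, hP⟩)
    rw [Finset.insert_inter_of_mem hyI, Finset.erase_inter,
      Finset.erase_eq_of_notMem fun h => hxI (Finset.mem_inter.mp h).2,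
      Finset.card_insert_of_notMem fun h => hyY (Finset.mem_inter.mp h).1] at hle
    omega
  refine ⟨K, hK, Y, hY, hcode, hcard, fun i hi j hj hij => ?_⟩
  rcases Finset.mem_symmDiff.mp hi with ⟨hiY, hiI⟩ | ⟨hiI, hiY⟩ <;>
    rcases Finset.mem_symmDiff.mp hj with ⟨hjY, hjI⟩ | ⟨hjI, hjY⟩
  · exact hindep hiY hjY hij
  · exact hcross hiY hiI hjI hjY
  · exact fun h => hcross hjY hjI hiI hiY h.symm
  · exact hindep' hiY hjY hij

theorem exists_le_two_pow_indepNum (hB : B ∈ lcOrbit G) (hbip : B.IsBipartite) :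
    ∃ K ∈ lcOrbit G, ∀ r ∈ productSpectrum (graphState B), r ≤ 2 ^ K.indepNum := by
  obtain ⟨X, hX⟩ := exists_isBipartiteWith_compl hbip
  obtain ⟨I, S, hIS⟩ := exists_add_compl_le
    (finrank_shortening_supermodular (closedNeighborCode B X))
  obtain ⟨K, hK, Y, hY, hcode, hcard, hindep⟩ := exists_isIndepSet_symmDiff hB hX I
  refine ⟨K, hK, fun r hr => (le_two_pow_of_mem_productSpectrum hX S hr).trans
    (pow_le_pow_right₀ one_le_two (le_trans ?_ hindep.card_le_indepNum))⟩
  have hdim := finrank_shortening_closedNeighborCode_le (isBipartiteWith_compl_iff.mp hY).2 I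
  rw [hcode] at hdim
  have hsymm : #(symmDiff Y I) = #(Y \ I) + #(I \ Y) :=
    Finset.card_union_of_disjoint disjoint_sdiff_sdiff
  have hXc := Finset.card_compl_add_card X
  have hIc := Finset.card_compl_add_card I
  have hYI := Finset.card_sdiff_add_card Y I
  have hIY := Finset.card_sdiff_add_card I Y
  rw [Finset.union_comm] at hIY
  omega

theorem isGreatest_powerSpectrum_two_pow_lam {K : SimpleGraph (Fin n)}
    (hbip : ∃ B ∈ lcOrbit G, B.IsBipartite) (hK : K ∈ lcOrbit G)
    {f : (Fin n → ZMod 2) → ZMod 2} (hf : Corresponds f K) :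
    IsGreatest (powerSpectrum transformU (signVector f)) ((2 : ℝ) ^ lam G) := by
  obtain ⟨B, hB, hbip⟩ := hbip
  obtain ⟨⟨M, hM, hlam⟩, hub⟩ := isGreatest_lam G
  rw [powerSpectrum_transformU_signVector, productSpectrum_eq_of_corresponds hf,
    productSpectrum_eq_of_mem_lcOrbit hK]
  constructor
  · rw [← hlam, ← productSpectrum_eq_of_mem_lcOrbit hM]
    exact two_pow_indepNum_mem_productSpectrum M
  · intro r hr
    obtain ⟨L, hL, hle⟩ := exists_le_two_pow_indepNum hB hbip
    rw [← productSpectrum_eq_of_mem_lcOrbit hB] at hr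
    exact (hle r hr).trans (pow_le_pow_right₀ one_le_two (hub ⟨L, hL, rfl⟩))

end Maximum

end BipartiteLC

theorem mainTheorem7 (n : ℕ) (G : SimpleGraph (Fin n))
    (hbip : ∃ B ∈ BipartiteLC.lcOrbit G, B.IsBipartite)
    (K : SimpleGraph (Fin n)) (hK : K ∈ BipartiteLC.lcOrbit G)
    (f : (Fin n → ZMod 2) → ZMod 2) (hf : BipartiteLC.Corresponds f K) :
    IsGreatest (BipartiteLC.powerSpectrum BipartiteLC.transformU (BipartiteLC.signVector f))
        (BipartiteLC.PAR BipartiteLC.transformU (BipartiteLC.signVector f)) ∧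
      BipartiteLC.PAR BipartiteLC.transformU (BipartiteLC.signVector f)
        = (2 : ℝ) ^ BipartiteLC.lam G := by
  have hmax := BipartiteLC.isGreatest_powerSpectrum_two_pow_lam hbip hK hf
  have hPAR : BipartiteLC.PAR BipartiteLC.transformU (BipartiteLC.signVector f) =
      (2 : ℝ) ^ BipartiteLC.lam G := hmax.csSup_eq
  exact ⟨hPAR ▸ hmax, hPAR⟩
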